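/- Let $\mathbf Z$ be the algebra of type $(\wedge,\vee,\to,\neg)$ on the chain of integers, with $\wedge=\min$, $\vee=\max$, $\neg a=-a$, and $a\to b=(-a)\vee b$ if $a\le b$, $a\to b=(-a)\wedge b$ otherwise. For $n\ge 0$ let $\mathbf Z_{2n+1}$ be its subalgebra with universe $\{a\in\mathbb Z: -n\le a\le n\}$, and for $n\ge 1$ let $\mathbf Z_{2n}$ be its subalgebra with universe $\{a\in\mathbb Z: -n\le a\le n,\ a\ne 0\}$. For a class $\mathcal K$ of (non-empty) algebras of this type let $\mathbb I(\mathcal K)$, $\mathbb H(\mathcal K)$, $\mathbb S(\mathcal K)$, $\mathbb P(\mathcal K)$ be the classes of isomorphic copies, homomorphic images, subalgebras and direct products (the empty product included) of members of $\mathcal K$. A variety is a class closed under $\mathbb H$, $\mathbb S$ and $\mathbb P$. Let $\mathcal{SA}=\mathbb{HSP}(\mathbf Z)$ be the variety of Sugihara algebras. (i) For every $m\ge 1$, $\mathbb{ISP}(\mathbf Z_{2m-1})=\mathbb{HSP}(\mathbf Z_{2m-1})$, and so $\mathbb{ISP}(\mathbf Z_{2m-1})$ is a variety. (ii) For every $m\ge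 2$, $\mathbb{ISP}(\mathbf Z_{2m})\subsetneq\mathbb{HSP}(\mathbf Z_{2m})$; and for every $m\ge 1$, $\mathbb{HSP}(\mathbf Z_{2m})=\mathbb{ISP}(\mathbf Z_{2m},\mathbf Z_{2m-1})$. (iii) For every $k\ge 1$, $\mathbb{HSP}(\mathbf Z_k)\subsetneq\mathbb{HSP}(\mathbf Z_{k+1})$ and $\mathbb{HSP}(\mathbf Z_k)\subsetneq\mathcal{SA}$; that is, $$\mathbb{HSP}(\mathbf Z_1)\subsetneq\mathbb{HSP}(\mathbf Z_2)\subsetneq\mathbb{HSP}(\mathbf Z_3)\subsetneq\cdots\subsetneq\mathcal{SA}.$$ -/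

import Mathlib

universe u

namespace Sugihara

/-- A (non-empty) algebra in the language `(∧, ∨, →, ¬)` of type `(2,2,2,1)`.  No identities are
imposed: these are all the algebras of the similarity type, among which the class operators act. -/
structure Alg : Type (u + 1) where
  carrier : Type u
  nonempty : Nonempty carrier
  meet : carrier → carrier → carrier
  join : carrier → carrier → carrier
  imp : carrier → carrier → carrier
  neg : carrier → carrier

namespace Alg

/-- Homomorphisms: maps preserving the four basic operations. -/
structure IsHom (A B : Alg.{u}) (f : A.carrier → B.carrier) : Prop where
  map_meet : ∀ a b, f (A.meet a b) = B.meet (f a) (f b)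
  map_join : ∀ a b, f (A.join a b) = B.join (f a) (f b)
  map_imp : ∀ a b, f (A.imp a b) = B.imp (f a) (f b)
  map_neg : ∀ a, f (A.neg a) = B.neg (f a)

/-- A subset is a subuniverse if it is non-empty and closed under the basic operations. -/
structure IsSubuniverse (A : Alg.{u}) (s : Set A.carrier) : Prop where
  nonempty : s.Nonempty
  meet_mem : ∀ {a b}, a ∈ s → b ∈ s → A.meet a b ∈ s
  join_mem : ∀ {a b}, a ∈ s → b ∈ s → A.join a b ∈ s
  imp_mem : ∀ {a b}, a ∈ s → b ∈ s → A.imp a b ∈ s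
  neg_mem : ∀ {a}, a ∈ s → A.neg a ∈ s

/-- The subalgebra of `A` with universe `s`. -/
def sub (A : Alg.{u}) (s : Set A.carrier) (h : A.IsSubuniverse s) : Alg.{u} where
  carrier := s
  nonempty := h.nonempty.to_subtype
  meet a b := ⟨A.meet a b, h.meet_mem a.2 b.2⟩
  join a b := ⟨A.join a b, h.join_mem a.2 b.2⟩
  imp a b := ⟨A.imp a b, h.imp_mem a.2 b.2⟩
  neg a := ⟨A.neg a, h.neg_mem a.2⟩

/-- The direct product of a family of algebras, with pointwise operations.  The index set may be
empty, in which case the product is the one-element algebra. -/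
def pi {ι : Type u} (F : ι → Alg.{u}) : Alg.{u} where
  carrier := ∀ i, (F i).carrier
  nonempty := ⟨fun i => Classical.choice (F i).nonempty⟩
  meet a b := fun i => (F i).meet (a i) (b i)
  join a b := fun i => (F i).join (a i) (b i)
  imp a b := fun i => (F i).imp (a i) (b i)
  neg a := fun i => (F i).neg (a i)

end Alg

/-- `𝕀(K)`: isomorphic copies of members of `K`. -/
def opI (K : Set Alg.{u}) : Set Alg.{u} :=
  {A | ∃ B ∈ K, ∃ f : B.carrier → A.carrier, Alg.IsHom B A f ∧ Function.Bijective f}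

/-- `ℍ(K)`: homomorphic images of members of `K`. -/
def opH (K : Set Alg.{u}) : Set Alg.{u} :=
  {A | ∃ B ∈ K, ∃ f : B.carrier → A.carrier, Alg.IsHom B A f ∧ Function.Surjective f}

/-- `𝕊(K)`: subalgebras of members of `K`. -/
def opS (K : Set Alg.{u}) : Set Alg.{u} :=
  {A | ∃ B ∈ K, ∃ (s : Set B.carrier) (h : B.IsSubuniverse s), A = B.sub s h}

/-- `ℙ(K)`: direct products of arbitrary families of members of `K`. -/
def opP (K : Set Alg.{u}) : Set Alg.{u} :=
  {A | ∃ (ι : Type u) (F : ι → Alg.{u}), (∀ i, F i ∈ K) ∧ A = Alg.pi F}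

/-- `𝕀𝕊ℙ(K)`. -/
def ISP (K : Set Alg.{u}) : Set Alg.{u} := opI (opS (opP K))

/-- `ℍ𝕊ℙ(K)`. -/
def HSP (K : Set Alg.{u}) : Set Alg.{u} := opH (opS (opP K))

/-- A variety: a class of algebras closed under homomorphic images (hence isomorphic copies),
subalgebras and direct products. -/
structure IsVariety (K : Set Alg.{u}) : Prop where
  opH_subset : opH K ⊆ K
  opS_subset : opS K ⊆ K
  opP_subset : opP K ⊆ K

/-- The implication on the chain of integers. -/
def intImp (a b : ℤ) : ℤ := if a ≤ b then max (-a) b else min (-a) b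

/-- The algebra `𝐙` on the chain of integers (lifted to the universe `u`). -/
def ZInt : Alg.{u} where
  carrier := ULift.{u} ℤ
  nonempty := ⟨⟨0⟩⟩
  meet a b := ⟨min a.down b.down⟩
  join a b := ⟨max a.down b.down⟩
  imp a b := ⟨intImp a.down b.down⟩
  neg a := ⟨-a.down⟩

/-- The universe of `𝐙_k`: it is `{a | -n ≤ a ≤ n}` for `k = 2n+1`, and this set without `0` for
`k = 2n`. -/
def zSet (k : ℕ) : Set ZInt.{u}.carrier :=
  {a | -((k / 2 : ℕ) : ℤ) ≤ a.down ∧ a.down ≤ ((k / 2 : ℕ) : ℤ) ∧ (Even k → a.down ≠ 0)}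

theorem zSet_isSubuniverse {k : ℕ} (hk : 1 ≤ k) : ZInt.{u}.IsSubuniverse (zSet.{u} k) where
  nonempty := by
    rcases Nat.even_or_odd k with h | h
    · refine ⟨⟨1⟩, ?_, ?_, fun _ => one_ne_zero⟩
      · change -((k / 2 : ℕ) : ℤ) ≤ 1
        omega
      · change (1 : ℤ) ≤ ((k / 2 : ℕ) : ℤ)
        obtain ⟨r, hr⟩ := h
        omega
    · refine ⟨⟨0⟩, ?_, ?_, fun h' => absurd h' (Nat.not_even_iff_odd.2 h)⟩
      · change -((k / 2 : ℕ) : ℤ) ≤ 0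
        omega
      · change (0 : ℤ) ≤ ((k / 2 : ℕ) : ℤ)
        omega
  meet_mem := by
    rintro ⟨a⟩ ⟨b⟩ ⟨h1, h2, h3⟩ ⟨h4, h5, h6⟩
    refine ⟨le_min h1 h4, (min_le_left _ _).trans h2, fun h => ?_⟩
    change min a b ≠ 0
    rcases min_choice a b with e | e <;> rw [e]
    exacts [h3 h, h6 h]
  join_mem := by
    rintro ⟨a⟩ ⟨b⟩ ⟨h1, h2, h3⟩ ⟨h4, h5, h6⟩
    refine ⟨h1.trans (le_max_left _ _), max_le h2 h5, fun h => ?_⟩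
    change max a b ≠ 0
    rcases max_choice a b with e | e <;> rw [e]
    exacts [h3 h, h6 h]
  imp_mem := by
    rintro ⟨a⟩ ⟨b⟩ ⟨h1, h2, h3⟩ ⟨h4, h5, h6⟩
    dsimp only at h1 h2 h3 h4 h5 h6
    have key : intImp a b = -a ∨ intImp a b = b := by
      unfold intImp
      split_ifs
      exacts [max_choice _ _, min_choice _ _]
    change -((k / 2 : ℕ) : ℤ) ≤ intImp a b ∧ intImp a b ≤ ((k / 2 : ℕ) : ℤ) ∧
      (Even k → intImp a b ≠ 0)
    rcases key with e | e <;> rw [e]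
    · exact ⟨by omega, by omega, fun h => neg_ne_zero.2 (h3 h)⟩
    · exact ⟨h4, h5, h6⟩
  neg_mem := by
    rintro ⟨a⟩ ⟨h1, h2, h3⟩
    exact ⟨neg_le_neg h2, neg_le.1 h1, fun h => neg_ne_zero.2 (h3 h)⟩

/-- The algebra `𝐙_k`, for `k ≥ 1`, a subalgebra of `𝐙`. -/
def Z (k : ℕ) (hk : 1 ≤ k) : Alg.{u} := ZInt.{u}.sub (zSet.{u} k) (zSet_isSubuniverse.{u} hk)

/-- The variety of Sugihara algebras: the variety generated by `𝐙`. -/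
def SA : Set Alg.{u} := HSP {ZInt.{u}}

end Sugihara

namespace Sugihara

/-! Everything rests on `exists_isIntHom_separating`. Let `g : B → A` be onto with `B` inside a
power of `𝐙_k`. The set `D` of all `z` with `g z = g |z|` is a lattice filter, and `g x = g y` iff
`x → y` and `y → x` lie in `D`. If `x → y ∉ D`, a prime ideal `J` contains `x → y` and misses `D`.
Each member of `J` has a negative coordinate and `J` is closed under joins, so some ultrafilter
makes all of `J` negative; as coordinates take finitely many values, the limit along it is a
homomorphism `h` from `B` to the integers. The complement of `J` is then `{z | -j ≤ h z}` for some
`j`, and collapsing `[-j, j]` to `0` after `h` gives a map that factors through `A` and separates `g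
x` from `g y`. Its values lie in `𝐙_k`, or in `𝐙_{k-1}` when `k` is even and `j > 0`.

Properness in (ii) holds because `¬` has a fixed point in `𝐙_{2m-1}` but not in `𝐙_{2m}`; in (iii),
because a homomorphism separating `1` from its predecessor in `𝐙_{k+1}` is injective, and no allowed
target is large enough. -/

/-- A homomorphism from `B` to the chain of integers, as an integer-valued function. -/
structure IsIntHom (B : Alg.{u}) (h : B.carrier → ℤ) : Prop where
  map_meet : ∀ a b, h (B.meet a b) = min (h a) (h b)
  map_join : ∀ a b, h (B.join a b) = max (h a) (h b)
  map_imp : ∀ a b, h (B.imp a b) = intImp (h a) (h b)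
  map_neg : ∀ a, h (B.neg a) = -h a

/-! ### Homomorphisms, subalgebras and products. -/

namespace Alg

theorem IsHom.comp {A B C : Alg.{u}} {g : B.carrier → C.carrier} {f : A.carrier → B.carrier}
    (hg : IsHom B C g) (hf : IsHom A B f) : IsHom A C (g ∘ f) where
  map_meet a b := by simp [hf.map_meet, hg.map_meet]
  map_join a b := by simp [hf.map_join, hg.map_join]
  map_imp a b := by simp [hf.map_imp, hg.map_imp]
  map_neg a := by simp [hf.map_neg, hg.map_neg]

theorem IsHom.id (A : Alg.{u}) : IsHom A A (fun a => a) :=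
  ⟨fun _ _ => rfl, fun _ _ => rfl, fun _ _ => rfl, fun _ => rfl⟩

theorem isHom_val (A : Alg.{u}) (s : Set A.carrier) (h : A.IsSubuniverse s) :
    IsHom (A.sub s h) A Subtype.val :=
  ⟨fun _ _ => rfl, fun _ _ => rfl, fun _ _ => rfl, fun _ => rfl⟩

theorem isHom_eval {ι : Type u} (F : ι → Alg.{u}) (i : ι) :
    IsHom (pi F) (F i) (fun x => x i) :=
  ⟨fun _ _ => rfl, fun _ _ => rfl, fun _ _ => rfl, fun _ => rfl⟩

theorem IsHom.toPi {ι : Type u} {F : ι → Alg.{u}} {A : Alg.{u}}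
    {f : ∀ i, A.carrier → (F i).carrier} (hf : ∀ i, IsHom A (F i) (f i)) :
    IsHom A (pi F) (fun a i => f i a) :=
  ⟨fun a b => funext fun i => (hf i).map_meet a b, fun a b => funext fun i => (hf i).map_join a b,
    fun a b => funext fun i => (hf i).map_imp a b, fun a => funext fun i => (hf i).map_neg a⟩

theorem IsHom.isSubuniverse_range {A B : Alg.{u}} {f : A.carrier → B.carrier}
    (hf : IsHom A B f) : B.IsSubuniverse (Set.range f) where
  nonempty := have := A.nonempty; Set.range_nonempty f
  meet_mem := by rintro _ _ ⟨a, rfl⟩ ⟨b, rfl⟩; exact ⟨_, hf.map_meet a b⟩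
  join_mem := by rintro _ _ ⟨a, rfl⟩ ⟨b, rfl⟩; exact ⟨_, hf.map_join a b⟩
  imp_mem := by rintro _ _ ⟨a, rfl⟩ ⟨b, rfl⟩; exact ⟨_, hf.map_imp a b⟩
  neg_mem := by rintro _ ⟨a, rfl⟩; exact ⟨_, hf.map_neg a⟩

theorem IsHom.isSubuniverse_preimage {A B : Alg.{u}} {f : A.carrier → B.carrier}
    (hf : IsHom A B f) (hs : Function.Surjective f) {s : Set B.carrier} (h : B.IsSubuniverse s) :
    A.IsSubuniverse (f ⁻¹' s) where
  nonempty := h.nonempty.preimage hs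
  meet_mem ha hb := by
    rw [Set.mem_preimage, hf.map_meet]; exact h.meet_mem ha hb
  join_mem ha hb := by
    rw [Set.mem_preimage, hf.map_join]; exact h.join_mem ha hb
  imp_mem ha hb := by
    rw [Set.mem_preimage, hf.map_imp]; exact h.imp_mem ha hb
  neg_mem ha := by
    rw [Set.mem_preimage, hf.map_neg]; exact h.neg_mem ha

/-- A homomorphism restricts to the subalgebras it respects. -/
theorem IsHom.subMap {A B : Alg.{u}} {f : A.carrier → B.carrier} (hf : IsHom A B f)
    {s : Set A.carrier} (hs : A.IsSubuniverse s) {t : Set B.carrier} (ht : B.IsSubuniverse t)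
    (hst : ∀ a ∈ s, f a ∈ t) :
    IsHom (A.sub s hs) (B.sub t ht) (fun a => ⟨f a.1, hst a.1 a.2⟩) :=
  ⟨fun a b => Subtype.ext (hf.map_meet a.1 b.1), fun a b => Subtype.ext (hf.map_join a.1 b.1),
    fun a b => Subtype.ext (hf.map_imp a.1 b.1), fun a => Subtype.ext (hf.map_neg a.1)⟩

theorem IsHom.codRestrict {A B : Alg.{u}} {f : A.carrier → B.carrier} (hf : IsHom A B f)
    {t : Set B.carrier} (ht : B.IsSubuniverse t) (hst : ∀ a, f a ∈ t) :
    IsHom A (B.sub t ht) (fun a => ⟨f a, hst a⟩) :=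
  ⟨fun a b => Subtype.ext (hf.map_meet a b), fun a b => Subtype.ext (hf.map_join a b),
    fun a b => Subtype.ext (hf.map_imp a b), fun a => Subtype.ext (hf.map_neg a)⟩

/-- The inverse of an injective homomorphism, followed by a homomorphism. -/
theorem IsHom.lift_range {A B C : Alg.{u}} {e : B.carrier → C.carrier} (he : IsHom B C e)
    (hinj : Function.Injective e) {g : B.carrier → A.carrier} (hg : IsHom B A g) :
    IsHom (C.sub (Set.range e) he.isSubuniverse_range) A (fun x => g x.2.choose) := by
  have key : ∀ (x : Set.range e) (b : B.carrier), e b = x.1 → x.2.choose = b := fun x b h =>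
    hinj (x.2.choose_spec.trans h.symm)
  refine ⟨fun a b => ?_, fun a b => ?_, fun a b => ?_, fun a => ?_⟩
  · rw [← hg.map_meet]
    exact congrArg g (key _ _ (by rw [he.map_meet, a.2.choose_spec, b.2.choose_spec]; rfl))
  · rw [← hg.map_join]
    exact congrArg g (key _ _ (by rw [he.map_join, a.2.choose_spec, b.2.choose_spec]; rfl))
  · rw [← hg.map_imp]
    exact congrArg g (key _ _ (by rw [he.map_imp, a.2.choose_spec, b.2.choose_spec]; rfl))
  · rw [← hg.map_neg]
    exact congrArg g (key _ _ (by rw [he.map_neg, a.2.choose_spec]; rfl))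

end Alg

open Alg

/-- The absolute value, the term `a ∨ ¬a`. -/
def Alg.abs (A : Alg.{u}) (a : A.carrier) : A.carrier := A.join a (A.neg a)

theorem IsIntHom.map_abs {B : Alg.{u}} {h : B.carrier → ℤ} (hh : IsIntHom B h) (a : B.carrier) :
    h (B.abs a) = max (h a) (-h a) := by
  rw [Alg.abs, hh.map_join, hh.map_neg]

theorem Alg.IsHom.map_abs {A B : Alg.{u}} {f : A.carrier → B.carrier} (hf : IsHom A B f)
    (a : A.carrier) : f (A.abs a) = B.abs (f a) := by
  rw [Alg.abs, hf.map_join, hf.map_neg, Alg.abs]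

/-! ### Class operators and varieties. -/

theorem mem_HSP {K : Set Alg.{u}} {A : Alg.{u}} :
    A ∈ HSP K ↔ ∃ (ι : Type u) (F : ι → Alg.{u}) (B : Alg.{u}) (e : B.carrier → (pi F).carrier)
      (g : B.carrier → A.carrier), (∀ i, F i ∈ K) ∧ IsHom B (pi F) e ∧ Function.Injective e ∧
        IsHom B A g ∧ Function.Surjective g := by
  constructor
  · rintro ⟨_, ⟨_, ⟨ι, F, hF, rfl⟩, s, hs, rfl⟩, g, hg, hsurj⟩
    exact ⟨ι, F, _, Subtype.val, g, hF, isHom_val _ s hs, Subtype.val_injective, hg, hsurj⟩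
  · rintro ⟨ι, F, B, e, g, hF, he, hinj, hg, hsurj⟩
    refine ⟨_, ⟨_, ⟨ι, F, hF, rfl⟩, _, he.isSubuniverse_range, rfl⟩, _,
      he.lift_range hinj hg, fun a => ?_⟩
    obtain ⟨b, rfl⟩ := hsurj a
    refine ⟨⟨e b, b, rfl⟩, congrArg g (hinj ?_)⟩
    exact Exists.choose_spec (⟨b, rfl⟩ : ∃ y, e y = e b)

theorem mem_ISP {K : Set Alg.{u}} {A : Alg.{u}} :
    A ∈ ISP K ↔ ∀ a b : A.carrier, a ≠ b →
      ∃ C ∈ K, ∃ f : A.carrier → C.carrier, IsHom A C f ∧ f a ≠ f b := by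
  constructor
  · rintro ⟨_, ⟨_, ⟨ι, F, hF, rfl⟩, s, hs, rfl⟩, g, hg, hbij⟩ a b hab
    obtain ⟨x, rfl⟩ := hbij.2 a
    obtain ⟨y, rfl⟩ := hbij.2 b
    have hxy : x.1 ≠ y.1 := fun h => hab (congrArg g (Subtype.ext h))
    obtain ⟨i, hi⟩ := Function.ne_iff.1 hxy
    have hr : ∀ z, g (Function.surjInv hbij.2 z) = z := Function.surjInv_eq hbij.2
    have hinv : IsHom A ((pi F).sub s hs) (Function.surjInv hbij.2) :=
      ⟨fun a b => hbij.1 (by simp only [hg.map_meet, hr]),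
        fun a b => hbij.1 (by simp only [hg.map_join, hr]),
        fun a b => hbij.1 (by simp only [hg.map_imp, hr]),
        fun a => hbij.1 (by simp only [hg.map_neg, hr])⟩
    refine ⟨F i, hF i, _, (isHom_eval F i).comp ((isHom_val _ s hs).comp hinv), ?_⟩
    have hl : ∀ z, Function.surjInv hbij.2 (g z) = z := fun z => hbij.1 (hr _)
    simpa only [Function.comp, hl] using hi
  · intro h
    choose C hC f hf hne using h
    let ι := {p : A.carrier × A.carrier // p.1 ≠ p.2}
    obtain ⟨e, he, hinj⟩ : ∃ e : A.carrier → (pi fun p : ι => C p.1.1 p.1.2 p.2).carrier,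
        IsHom A _ e ∧ Function.Injective e := by
      refine ⟨_, IsHom.toPi fun p : ι => hf p.1.1 p.1.2 p.2, fun a b hab => ?_⟩
      by_contra hne'
      exact hne a b hne' (congrFun hab ⟨(a, b), hne'⟩)
    refine ⟨_, ⟨_, ⟨ι, _, fun p => hC p.1.1 p.1.2 p.2, rfl⟩, _, he.isSubuniverse_range, rfl⟩, _,
      he.lift_range hinj (IsHom.id A), fun x y hxy => Subtype.ext ?_, fun a => ?_⟩
    · exact x.2.choose_spec.symm.trans ((congrArg e hxy).trans y.2.choose_spec)
    · exact ⟨⟨e a, a, rfl⟩, hinj (Exists.choose_spec (⟨a, rfl⟩ : ∃ b, e b = e a))⟩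

theorem isVariety_HSP (K : Set Alg.{u}) : IsVariety (HSP K) where
  opH_subset := by
    rintro A ⟨A', hA', f, hf, hfs⟩
    obtain ⟨ι, F, B, e, g, hF, he, hinj, hg, hsurj⟩ := mem_HSP.1 hA'
    exact mem_HSP.2 ⟨ι, F, B, e, f ∘ g, hF, he, hinj, hf.comp hg, hfs.comp hsurj⟩
  opS_subset := by
    rintro _ ⟨A', hA', s, hs, rfl⟩
    obtain ⟨ι, F, B, e, g, hF, he, hinj, hg, hsurj⟩ := mem_HSP.1 hA'
    have hs' := hg.isSubuniverse_preimage hsurj hs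
    refine mem_HSP.2 ⟨ι, F, B.sub _ hs', e ∘ Subtype.val, _, hF, he.comp (isHom_val _ _ hs'),
      hinj.comp Subtype.val_injective, hg.subMap hs' hs fun _ h => h, ?_⟩
    rintro ⟨a, ha⟩
    obtain ⟨b, rfl⟩ := hsurj a
    exact ⟨⟨b, ha⟩, rfl⟩
  opP_subset := by
    rintro _ ⟨κ, A, hA, rfl⟩
    choose ι F B e g hF he hinj hg hsurj using fun i => mem_HSP.1 (hA i)
    refine mem_HSP.2 ⟨Σ i, ι i, fun p => F p.1 p.2, pi B, fun x p => e p.1 (x p.1) p.2,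
      fun x i => g i (x i), fun p => hF p.1 p.2, IsHom.toPi fun p => ?_, fun x y hxy => ?_,
      IsHom.toPi fun i => (hg i).comp (isHom_eval B i), fun a => ?_⟩
    · exact (isHom_eval (F p.1) p.2).comp ((he p.1).comp (isHom_eval B p.1))
    · exact funext fun i => hinj i (funext fun j => congrFun hxy ⟨i, j⟩)
    · choose b hb using fun i => hsurj i (a i)
      exact ⟨b, funext hb⟩

theorem HSP_subset_of_isVariety {K V : Set Alg.{u}} (hV : IsVariety V) (hK : K ⊆ V) :
    HSP K ⊆ V := by
  rintro A ⟨B, ⟨C, ⟨ι, F, hF, rfl⟩, s, hs, rfl⟩, f, hf⟩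
  exact hV.opH_subset ⟨_, hV.opS_subset ⟨_, hV.opP_subset ⟨ι, F, fun i => hK (hF i), rfl⟩,
    s, hs, rfl⟩, f, hf⟩

theorem ISP_subset_HSP (K : Set Alg.{u}) : ISP K ⊆ HSP K :=
  fun _ ⟨B, hB, f, hf, hb⟩ => ⟨B, hB, f, hf, hb.2⟩

theorem subset_ISP (K : Set Alg.{u}) : K ⊆ ISP K := fun A hA =>
  mem_ISP.2 fun _ _ hab => ⟨A, hA, _, IsHom.id A, hab⟩

theorem subset_HSP (K : Set Alg.{u}) : K ⊆ HSP K := (subset_ISP K).trans (ISP_subset_HSP K)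

/-! ### Homomorphisms into the chain of integers. -/

theorem isIntHom_iff {B : Alg.{u}} {h : B.carrier → ℤ} :
    IsIntHom B h ↔ IsHom B ZInt.{u} fun b => ⟨h b⟩ :=
  ⟨fun H => ⟨fun a b => congrArg ULift.up (H.map_meet a b),
      fun a b => congrArg ULift.up (H.map_join a b), fun a b => congrArg ULift.up (H.map_imp a b),
      fun a => congrArg ULift.up (H.map_neg a)⟩,
    fun H => ⟨fun a b => congrArg ULift.down (H.map_meet a b),
      fun a b => congrArg ULift.down (H.map_join a b),
      fun a b => congrArg ULift.down (H.map_imp a b), fun a => congrArg ULift.down (H.map_neg a)⟩⟩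

theorem IsIntHom.comp_isHom {A B : Alg.{u}} {h : B.carrier → ℤ} (hh : IsIntHom B h)
    {f : A.carrier → B.carrier} (hf : IsHom A B f) : IsIntHom A (h ∘ f) :=
  isIntHom_iff.2 ((isIntHom_iff.1 hh).comp hf)

theorem isIntHom_Z (k : ℕ) (hk : 1 ≤ k) : IsIntHom (Z.{u} k hk) fun x => x.1.down :=
  isIntHom_iff.2 (isHom_val _ _ _)

/-- Move every integer towards `0` by `j` steps, stopping at `0`. -/
def shrink (j n : ℤ) : ℤ := max (n - j) 0 + min (n + j) 0

/-- A monotone odd map respects `∧`, `∨`, `¬`, and also `→` except where it identifies some `a > b`.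
Shrinking identifies these only at `0`, where both sides vanish. -/
theorem IsIntHom.shrink {B : Alg.{u}} {h : B.carrier → ℤ} (hh : IsIntHom B h) {j : ℤ}
    (hj : 0 ≤ j) : IsIntHom B fun b => Sugihara.shrink j (h b) := by
  refine ⟨fun a b => ?_, fun a b => ?_, fun a b => ?_, fun a => ?_⟩
  · rw [hh.map_meet]; simp only [Sugihara.shrink]; omega
  · rw [hh.map_join]; simp only [Sugihara.shrink]; omega
  · rw [hh.map_imp]; simp only [Sugihara.shrink, intImp]; split_ifs <;> omega
  · rw [hh.map_neg]; simp only [Sugihara.shrink]; omega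

/-- A homomorphism from `A` to the integers with values in the universe of `𝐙_k` is a homomorphism
to `𝐙_k`. -/
theorem IsIntHom.exists_isHom_Z {A : Alg.{u}} {h : A.carrier → ℤ} (hh : IsIntHom A h) {k : ℕ}
    (hk : 1 ≤ k) (hz : ∀ a, (⟨h a⟩ : ULift.{u} ℤ) ∈ zSet.{u} k) :
    ∃ f : A.carrier → (Z.{u} k hk).carrier, IsHom A (Z.{u} k hk) f ∧ ∀ a, (f a).1.down = h a :=
  ⟨fun a => ⟨⟨h a⟩, hz a⟩, (isIntHom_iff.1 hh).codRestrict _ hz, fun _ => rfl⟩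

/-! ### Prime ideals and ultrafilter limits. -/

theorem exists_prime_ideal_separating {I : Type*} {B : Alg.{u}} {ev : I → B.carrier → ℤ}
    (hev : ∀ i, IsIntHom B (ev i)) (hinj : ∀ x y, (∀ i, ev i x = ev i y) → x = y)
    {D : Set B.carrier} (hne : D.Nonempty)
    (hup : ∀ x ∈ D, ∀ y, (∀ i, ev i x ≤ ev i y) → y ∈ D)
    (hmeet : ∀ x ∈ D, ∀ y ∈ D, B.meet x y ∈ D) {c : B.carrier} (hc : c ∉ D) :
    ∃ J : Set B.carrier, c ∈ J ∧ (∀ x ∈ D, x ∉ J) ∧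
      (∀ x ∈ J, ∀ y, (∀ i, ev i y ≤ ev i x) → y ∈ J) ∧ (∀ x ∈ J, ∀ y ∈ J, B.join x y ∈ J) ∧
      ∀ x y, B.meet x y ∈ J → x ∈ J ∨ y ∈ J := by
  let E : B.carrier → I → ℤ := fun x i => ev i x
  let : Max B.carrier := ⟨B.join⟩
  let : Min B.carrier := ⟨B.meet⟩
  let : LE B.carrier := ⟨fun x y => E x ≤ E y⟩
  let : LT B.carrier := ⟨fun x y => E x < E y⟩
  let : DistribLattice B.carrier := Function.Injective.distribLattice E
    (fun x y h => hinj x y (congrFun h)) Iff.rfl Iff.rfl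
    (fun x y => funext fun i => (hev i).map_join x y)
    (fun x y => funext fun i => (hev i).map_meet x y)
  have hF : Order.IsPFilter D := by
    refine Order.IsPFilter.of_def hne (fun x hx y hy => ⟨x ⊓ y, hmeet x hx y hy, ?_, ?_⟩)
      fun {x y} hxy hx => hup x hx y hxy
    exacts [inf_le_left, inf_le_right]
  obtain ⟨J, hJ, hcJ, hdis⟩ := DistribLattice.prime_ideal_of_disjoint_filter_ideal
    (F := hF.toPFilter) (I := Order.Ideal.principal c)
    (Set.disjoint_left.2 fun x hx hxc => hc (hup x hx c hxc))
  exact ⟨J, hcJ Order.Ideal.mem_principal_self, fun x hx => Set.disjoint_left.1 hdis hx,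
    fun x hx y hyx => J.lower hyx hx, fun x hx y hy => J.sup_mem hx hy,
    fun x y h => hJ.mem_or_mem h⟩

/-- Finitely many possible values force each element to be constant on a set of the ultrafilter; an
identity between values is then checked at one common coordinate. -/
theorem exists_isIntHom_ultrafilter {I : Type*} {B : Alg.{u}} {ev : I → B.carrier → ℤ}
    (hev : ∀ i, IsIntHom B (ev i)) {n : ℤ} (hn : ∀ i x, -n ≤ ev i x ∧ ev i x ≤ n)
    (U : Ultrafilter I) :
    ∃ h : B.carrier → ℤ, IsIntHom B h ∧ ∀ x, ∀ᶠ i in U, ev i x = h x := by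
  have hex : ∀ x, ∃ v, ∀ᶠ i in U, ev i x = v := fun x => by
    obtain ⟨v, -, hv⟩ := (Ultrafilter.eventually_exists_mem_iff (f := U)
      (P := fun v i => ev i x = v) (Set.finite_Icc (-n) n)).1
      (Filter.Eventually.of_forall fun i => ⟨_, hn i x, rfl⟩)
    exact ⟨v, hv⟩
  choose h hh using hex
  refine ⟨h, ⟨fun a b => ?_, fun a b => ?_, fun a b => ?_, fun a => ?_⟩, hh⟩
  · obtain ⟨i, h1, h2, h3⟩ := ((hh a).and ((hh b).and (hh _))).exists
    rw [← h1, ← h2, ← h3, (hev i).map_meet]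
  · obtain ⟨i, h1, h2, h3⟩ := ((hh a).and ((hh b).and (hh _))).exists
    rw [← h1, ← h2, ← h3, (hev i).map_join]
  · obtain ⟨i, h1, h2, h3⟩ := ((hh a).and ((hh b).and (hh _))).exists
    rw [← h1, ← h2, ← h3, (hev i).map_imp]
  · obtain ⟨i, h1, h2⟩ := ((hh a).and (hh _)).exists
    rw [← h1, ← h2, (hev i).map_neg]

/-! ### The filter attached to a homomorphism, and separation of points. -/

/-- The elements whose image under `g` is its own absolute value. -/
def absFixed {A B : Alg.{u}} (g : B.carrier → A.carrier) : Set B.carrier :=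
  {z | g z = g (B.abs z)}

section

variable {I : Type*} {A B : Alg.{u}} {ev : I → B.carrier → ℤ} {g : B.carrier → A.carrier}

theorem absFixed_up (hev : ∀ i, IsIntHom B (ev i)) (hinj : ∀ x y, (∀ i, ev i x = ev i y) → x = y)
    (hg : IsHom B A g) {x : B.carrier} (hx : x ∈ absFixed g) {y : B.carrier}
    (hxy : ∀ i, ev i x ≤ ev i y) : y ∈ absFixed g := by
  have hx : g x = g (B.abs x) := hx
  -- For `x ≤ y`, both `y = |y| ∧ (y ∨ x)` and `|y| ∧ (y ∨ |x|) = |y|` hold in the integers; `g`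
  -- does not distinguish `x` from `|x|`.
  calc g y = g (B.meet (B.abs y) (B.join y x)) := by
        refine congrArg g (hinj _ _ fun i => ?_)
        have := hxy i
        simp only [(hev i).map_meet, (hev i).map_join, (hev i).map_abs]
        omega
    _ = g (B.meet (B.abs y) (B.join y (B.abs x))) := by
        simp only [hg.map_meet, hg.map_join, ← hx]
    _ = g (B.abs y) := by
        refine congrArg g (hinj _ _ fun i => ?_)
        have := hxy i
        simp only [(hev i).map_meet, (hev i).map_join, (hev i).map_abs]
        omega

theorem absFixed_meet (hev : ∀ i, IsIntHom B (ev i))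
    (hinj : ∀ x y, (∀ i, ev i x = ev i y) → x = y) (hg : IsHom B A g) {x y : B.carrier}
    (hx : x ∈ absFixed g) (hy : y ∈ absFixed g) : B.meet x y ∈ absFixed g := by
  have hx : g x = g (B.abs x) := hx
  have hy : g y = g (B.abs y) := hy
  calc g (B.meet x y) = g (B.meet (B.abs x) (B.abs y)) := by simp only [hg.map_meet, ← hx, ← hy]
    _ = g (B.join (B.join (B.meet (B.abs x) (B.abs y)) (B.neg (B.abs x))) (B.neg (B.abs y))) := by
        refine congrArg g (hinj _ _ fun i => ?_)
        simp only [(hev i).map_meet, (hev i).map_join, (hev i).map_abs, (hev i).map_neg]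
        omega
    _ = g (B.join (B.join (B.meet x y) (B.neg x)) (B.neg y)) := by
        simp only [hg.map_meet, hg.map_join, hg.map_neg, ← hx, ← hy]
    _ = g (B.abs (B.meet x y)) := by
        refine congrArg g (hinj _ _ fun i => ?_)
        simp only [(hev i).map_meet, (hev i).map_join, (hev i).map_abs, (hev i).map_neg]
        omega

/-- In the integers `x ≤ |x → y|` and `x ∧ (x → y) ≤ y`; under `g` the two implications coincide. -/
theorem map_eq_map_meet_of_imp_mem_absFixed (hev : ∀ i, IsIntHom B (ev i))
    (hinj : ∀ x y, (∀ i, ev i x = ev i y) → x = y) (hg : IsHom B A g) {x y : B.carrier}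
    (hc : B.imp x y ∈ absFixed g) : g x = g (B.meet x y) := by
  have hc : g (B.imp x y) = g (B.abs (B.imp x y)) := hc
  have key : ∀ i, ev i x = ev i (B.meet x (B.abs (B.imp x y))) := fun i => by
    simp only [(hev i).map_meet, (hev i).map_abs, (hev i).map_imp, intImp]
    split_ifs <;> omega
  calc g x = g (B.meet x (B.abs (B.imp x y))) := congrArg g (hinj _ _ key)
    _ = g (B.meet x (B.imp x y)) := by simp only [hg.map_meet, ← hc]
    _ = g (B.meet (B.meet x (B.imp x y)) y) := by
        refine congrArg g (hinj _ _ fun i => ?_)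
        simp only [(hev i).map_meet, (hev i).map_imp, intImp]
        split_ifs <;> omega
    _ = g (B.meet (B.meet x (B.abs (B.imp x y))) y) := by simp only [hg.map_meet, ← hc]
    _ = g (B.meet x y) := by rw [← hinj _ _ key]

theorem imp_mem_absFixed (hev : ∀ i, IsIntHom B (ev i))
    (hinj : ∀ x y, (∀ i, ev i x = ev i y) → x = y) (hg : IsHom B A g) {x y : B.carrier}
    (hxy : g x = g y) : B.imp x y ∈ absFixed g := by
  have h1 : g (B.imp x y) = g (B.imp x x) := by simp only [hg.map_imp, hxy]
  have h2 : B.imp x x = B.abs (B.imp x x) := by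
    refine hinj _ _ fun i => ?_
    simp only [(hev i).map_abs, (hev i).map_imp, intImp]
    split_ifs <;> omega
  change _ = _
  rw [hg.map_abs, h1, ← hg.map_abs, ← h2]

theorem exists_shrink_separating_of_imp (hev : ∀ i, IsIntHom B (ev i))
    (hinj : ∀ x y, (∀ i, ev i x = ev i y) → x = y) {n : ℕ}
    (hn : ∀ i x, -(n : ℤ) ≤ ev i x ∧ ev i x ≤ n) (hg : IsHom B A g) {x y : B.carrier}
    (hxy : B.imp x y ∉ absFixed g) :
    ∃ (h : B.carrier → ℤ) (j : ℕ), IsIntHom B h ∧ j ≤ n ∧ (∀ z, ∃ i, ev i z = h z) ∧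
      (∀ z w, g z = g w → shrink j (h z) = shrink j (h w)) ∧
      shrink j (h x) ≠ shrink j (h y) := by
  have hDne : (absFixed g).Nonempty :=
    ⟨B.imp x x, imp_mem_absFixed hev hinj hg rfl⟩
  obtain ⟨J, hcJ, hDJ, hdown, hjoin, hprime⟩ := exists_prime_ideal_separating hev hinj hDne
    (fun _ hx _ h => absFixed_up hev hinj hg hx h)
    (fun _ hx _ hy => absFixed_meet hev hinj hg hx hy) hxy
  -- No element of `J` is non-negative in all coordinates.
  have hneg : ∀ z ∈ J, ∃ i, ev i z < 0 := by
    intro z hz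
    by_contra! hcon
    refine hDJ z (congrArg g (hinj _ _ fun i => ?_)) hz
    have := hcon i
    rw [(hev i).map_abs]
    omega
  obtain ⟨U, hU⟩ : ∃ U : Ultrafilter I, ∀ z ∈ J, ∀ᶠ i in U, ev i z < 0 := by
    -- A finite intersection of these negativity sets contains the one of a join of members of `J`,
    -- which is nonempty.
    obtain ⟨U, hU⟩ := Ultrafilter.exists_ultrafilter_of_finite_inter_nonempty
      ((fun z => {i | ev i z < 0}) '' J) (fun T hT => by
        classical
        suffices ∃ z ∈ J, ∀ i, ev i z < 0 → i ∈ ⋂₀ (T : Set (Set I)) by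
          obtain ⟨z, hz, h⟩ := this
          obtain ⟨i, hi⟩ := hneg z hz
          exact ⟨i, h i hi⟩
        induction T using Finset.induction_on with
        | empty => exact ⟨_, hcJ, fun i _ => by simp⟩
        | insert a T _ ih =>
          rw [Finset.coe_insert] at hT ⊢
          obtain ⟨z, hz, h⟩ := ih ((Set.subset_insert _ _).trans hT)
          obtain ⟨w, hw, rfl⟩ := hT (Set.mem_insert _ _)
          refine ⟨_, hjoin z hz w hw, fun i hi => ?_⟩
          rw [(hev i).map_join, max_lt_iff] at hi
          rw [Set.sInter_insert]
          exact ⟨hi.2, h i hi.1⟩)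
    exact ⟨U, fun z hz => hU ⟨z, hz, rfl⟩⟩
  obtain ⟨h, hh, hev'⟩ := exists_isIntHom_ultrafilter hev hn U
  have hJneg : ∀ z ∈ J, h z < 0 := fun z hz => by
    obtain ⟨i, h1, h2⟩ := ((hU z hz).and (hev' z)).exists
    omega
  have hval : ∀ z, ∃ i, ev i z = h z := fun z => (hev' z).exists
  -- The complement of `J` is the preimage under `h` of an up-set: if `h z ≤ h w < 0` then `h (z →
  -- w) > 0`, so `z → w ∉ J`, and `z ∧ (z → w) ≤ w` with primeness keeps `w` out of `J`.
  have hmp : ∀ z w, z ∉ J → h z ≤ h w → w ∉ J := by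
    intro z w hz hzw hw
    have hi : B.imp z w ∉ J := fun hi => by
      have := hJneg _ hi
      have := hJneg _ hw
      simp only [hh.map_imp, intImp, if_pos hzw] at *
      omega
    have hm : B.meet z (B.imp z w) ∈ J := by
      refine hdown w hw _ fun i => ?_
      simp only [(hev i).map_meet, (hev i).map_imp, intImp]
      split_ifs <;> omega
    exact (hprime _ _ hm).elim hz hi
  -- The least such `m` is the radius `j` of the interval to collapse.
  have hP : ∃ m : ℕ, ∀ z ∉ J, -(m : ℤ) ≤ h z := ⟨n, fun z _ => by
    obtain ⟨i, hi⟩ := hval z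
    exact hi ▸ (hn i z).1⟩
  classical
  have hjn : Nat.find hP ≤ n := Nat.find_min' hP fun z _ => by
    obtain ⟨i, hi⟩ := hval z
    exact hi ▸ (hn i z).1
  have hj := Nat.find_spec hP
  have hj' : Nat.find hP ≠ 0 → ∃ z ∉ J, h z = -(Nat.find hP : ℤ) := fun h0 => by
    have := Nat.find_min hP (Nat.sub_one_lt h0)
    push Not at this
    obtain ⟨z, hz, hlt⟩ := this
    have := hj z hz
    exact ⟨z, hz, by omega⟩
  generalize Nat.find hP = j at *
  refine ⟨h, j, hh, hjn, hval, ?_, ?_⟩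
  -- Here `z → w ∉ J` gives `-j ≤ min (-h z) (h w)`, so `h w < h z` both lie in `[-j, j]` and shrink
  -- to `0`.
  · have aux : ∀ z w, g z = g w → h w < h z → shrink j (h z) = shrink j (h w) := by
      intro z w hzw hlt
      have := hj _ (hDJ _ (imp_mem_absFixed hev hinj hg hzw))
      rw [hh.map_imp, intImp, if_neg (by omega)] at this
      simp only [shrink]
      omega
    intro z w hzw
    rcases lt_trichotomy (h z) (h w) with hlt | heq | hlt
    · exact (aux w z hzw.symm hlt).symm
    · rw [heq]
    · exact aux z w hzw hlt
  · have hc0 := hJneg _ hcJ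
    have hcj : h (B.imp x y) < -j := by
      by_contra! hcon
      -- Since `h (x → y) < 0`, the contrary assumption forces `j ≠ 0`, so the bound `-j` is
      -- attained outside `J`.
      obtain ⟨z, hz, hzj⟩ := hj' (by omega)
      exact hmp z _ hz (by omega) hcJ
    rw [hh.map_imp, intImp] at hc0 hcj
    simp only [shrink]
    split_ifs at hc0 hcj <;> omega

theorem exists_shrink_separating (hev : ∀ i, IsIntHom B (ev i))
    (hinj : ∀ x y, (∀ i, ev i x = ev i y) → x = y) {n : ℕ}
    (hn : ∀ i x, -(n : ℤ) ≤ ev i x ∧ ev i x ≤ n) (hg : IsHom B A g) {x y : B.carrier}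
    (hxy : g x ≠ g y) :
    ∃ (h : B.carrier → ℤ) (j : ℕ), IsIntHom B h ∧ j ≤ n ∧ (∀ z, ∃ i, ev i z = h z) ∧
      (∀ z w, g z = g w → shrink j (h z) = shrink j (h w)) ∧
      shrink j (h x) ≠ shrink j (h y) := by
  by_cases h1 : B.imp x y ∈ absFixed g
  · by_cases h2 : B.imp y x ∈ absFixed g
    · refine absurd ?_ hxy
      rw [map_eq_map_meet_of_imp_mem_absFixed hev hinj hg h1,
        map_eq_map_meet_of_imp_mem_absFixed hev hinj hg h2]
      refine congrArg g (hinj _ _ fun i => ?_)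
      rw [(hev i).map_meet, (hev i).map_meet, min_comm]
    · obtain ⟨h, j, H1, H2, H3, H4, H5⟩ := exists_shrink_separating_of_imp hev hinj hn hg h2
      exact ⟨h, j, H1, H2, H3, H4, H5.symm⟩
  · exact exists_shrink_separating_of_imp hev hinj hn hg h1

end

theorem IsIntHom.of_surjective {A B : Alg.{u}} {g : B.carrier → A.carrier} (hg : IsHom B A g)
    (hs : Function.Surjective g) {f : A.carrier → ℤ} (hf : IsIntHom B (f ∘ g)) : IsIntHom A f := by
  refine ⟨fun a b => ?_, fun a b => ?_, fun a b => ?_, fun a => ?_⟩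
  all_goals obtain ⟨a, rfl⟩ := hs a
  · obtain ⟨b, rfl⟩ := hs b
    rw [← hg.map_meet]; exact hf.map_meet a b
  · obtain ⟨b, rfl⟩ := hs b
    rw [← hg.map_join]; exact hf.map_join a b
  · obtain ⟨b, rfl⟩ := hs b
    rw [← hg.map_imp]; exact hf.map_imp a b
  · rw [← hg.map_neg]; exact hf.map_neg a

/-! ### The varieties generated by the finite chains. -/

/-- The members of the variety generated by `𝐙_k` are separated by their homomorphisms into `𝐙_k`
and, if `k` is even, into `𝐙_{k-1}`. -/
theorem exists_isIntHom_separating {k : ℕ} (hk : 1 ≤ k) {A : Alg.{u}}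
    (hA : A ∈ HSP {Z.{u} k hk}) {a b : A.carrier} (hab : a ≠ b) :
    ∃ (l : ℕ) (f : A.carrier → ℤ), (l = k ∨ Even k ∧ l + 1 = k) ∧ IsIntHom A f ∧
      (∀ c, (⟨f c⟩ : ULift.{u} ℤ) ∈ zSet.{u} l) ∧ f a ≠ f b := by
  obtain ⟨ι, F, B, e, g, hF, he, hinj, hg, hsurj⟩ := mem_HSP.1 hA
  obtain rfl : F = fun _ => Z k hk := funext hF
  obtain ⟨x, rfl⟩ := hsurj a
  obtain ⟨y, rfl⟩ := hsurj b
  let ev : ι → B.carrier → ℤ := fun i z => (e z i).1.down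
  have hmem : ∀ i z, -((k / 2 : ℕ) : ℤ) ≤ ev i z ∧ ev i z ≤ ((k / 2 : ℕ) : ℤ) ∧
    (Even k → ev i z ≠ 0) := fun i z => (e z i).2
  obtain ⟨h, j, hh, hj, hval, hker, hne⟩ := exists_shrink_separating (ev := ev)
    (fun i => (isIntHom_Z k hk).comp_isHom ((isHom_eval _ i).comp he))
    (fun z w hzw => hinj (funext fun i => Subtype.ext (ULift.ext _ _ (hzw i))))
    (fun i z => ⟨(hmem i z).1, (hmem i z).2.1⟩) hg hab
  have hfac : ∀ z, shrink j (h (Function.surjInv hsurj (g z))) = shrink j (h z) := fun z =>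
    hker _ _ (Function.surjInv_eq hsurj _)
  have hf : IsIntHom A fun c => shrink j (h (Function.surjInv hsurj c)) := by
    refine .of_surjective hg hsurj ?_
    rw [show (fun c => shrink j (h (Function.surjInv hsurj c))) ∘ g = fun z => shrink j (h z) from
      funext hfac]
    exact hh.shrink (Int.natCast_nonneg j)
  have hb : ∀ z, -((k / 2 : ℕ) : ℤ) ≤ h z ∧ h z ≤ ((k / 2 : ℕ) : ℤ) ∧ (Even k → h z ≠ 0) :=
    fun z => by
      obtain ⟨i, hi⟩ := hval z
      exact hi ▸ hmem i z
  -- Collapsing an interval of positive radius may create the value `0`, absent from `𝐙_k` for even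
  -- `k`, but it lowers the bound by at least one, as `𝐙_{k-1}` requires.
  by_cases hcase : Even k ∧ j ≠ 0
  · obtain ⟨hke, hj0⟩ := hcase
    refine ⟨k - 1, _, .inr ⟨hke, by omega⟩, hf, fun c => ?_, by rwa [hfac, hfac]⟩
    have := hb (Function.surjInv hsurj c)
    have hodd : ¬ Even (k - 1) := by grind
    have hk2 : (k - 1) / 2 + 1 = k / 2 := by grind
    refine ⟨?_, ?_, fun h => absurd h hodd⟩
    all_goals simp only [shrink]; omega
  · refine ⟨k, _, .inl rfl, hf, fun c => ?_, by rwa [hfac, hfac]⟩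
    obtain ⟨h1, h2, h3⟩ := hb (Function.surjInv hsurj c)
    refine ⟨?_, ?_, fun hke => ?_⟩
    · simp only [shrink]; omega
    · simp only [shrink]; omega
    · have := h3 hke
      obtain rfl : j = 0 := by tauto
      simp only [shrink]
      omega

theorem Z_eq_of_eq {k l : ℕ} (h : k = l) (hk : 1 ≤ k) (hl : 1 ≤ l) : Z.{u} k hk = Z l hl := by
  subst h; rfl

theorem HSP_Z_subset_ISP_of_odd {k : ℕ} (hk : 1 ≤ k) (ho : ¬ Even k) :
    HSP {Z.{u} k hk} ⊆ ISP {Z.{u} k hk} := by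
  refine fun A hA => mem_ISP.2 fun a b hab => ?_
  obtain ⟨l, f, hl, hf, hz, hne⟩ := exists_isIntHom_separating hk hA hab
  obtain rfl : l = k := hl.resolve_right fun h => ho h.1
  obtain ⟨f', hf', h⟩ := hf.exists_isHom_Z hk hz
  exact ⟨_, rfl, f', hf', fun heq => hne (by rw [← h, ← h, heq])⟩

theorem HSP_Z_subset_ISP_pair {k : ℕ} (hk : 1 ≤ k) (hk' : 1 ≤ k - 1) :
    HSP {Z.{u} k hk} ⊆ ISP {Z.{u} k hk, Z.{u} (k - 1) hk'} := by
  refine fun A hA => mem_ISP.2 fun a b hab => ?_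
  obtain ⟨l, f, hl, hf, hz, hne⟩ := exists_isIntHom_separating hk hA hab
  obtain ⟨f', hf', h⟩ := hf.exists_isHom_Z (by omega) hz
  refine ⟨_, ?_, f', hf', fun heq => hne (by rw [← h, ← h, heq])⟩
  rcases hl with rfl | ⟨-, hl⟩
  · exact .inl rfl
  · exact .inr (Z_eq_of_eq (by omega) _ _)

/-- `𝐙_{k}` is a homomorphic image of `𝐙_{k+1}` if `k + 1` is even, and a subalgebra of it
up to isomorphism otherwise. -/
theorem Z_mem_HSP_succ {k : ℕ} (hk : 1 ≤ k) (hk' : 1 ≤ k + 1) :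
    Z.{u} k hk ∈ HSP {Z.{u} (k + 1) hk'} := by
  rcases Nat.even_or_odd k with he | ho
  · refine ISP_subset_HSP _ (mem_ISP.2 fun a b hab => ⟨_, rfl, ?_⟩)
    obtain ⟨f, hf, h⟩ := (isIntHom_Z k hk).exists_isHom_Z (k := k + 1) hk' fun a => by
      obtain ⟨h1, h2, -⟩ := a.2
      exact ⟨by dsimp only; omega, by dsimp only; omega, fun h => absurd he (by grind)⟩
    exact ⟨f, hf, fun heq => hab (Subtype.ext (ULift.ext _ _ (by rw [← h, ← h, heq])))⟩
  · have hk2 : (k + 1) / 2 = k / 2 + 1 := by grind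
    have hke : Even (k + 1) := ho.add_one
    obtain ⟨f, hf, h⟩ := ((isIntHom_Z (k + 1) hk').shrink zero_le_one).exists_isHom_Z hk fun a => by
      obtain ⟨h1, h2, -⟩ := a.2
      refine ⟨?_, ?_, fun h => absurd ho (by grind)⟩
      all_goals simp only [shrink]; omega
    refine (isVariety_HSP _).opH_subset ⟨_, subset_HSP _ rfl, f, hf, fun c => ?_⟩
    obtain ⟨h1, h2, -⟩ := c.2
    -- A preimage under shrinking by one: move away from `0`, with `0` itself lifted to `1`.
    have hz : (⟨if 0 ≤ c.1.down then c.1.down + 1 else c.1.down - 1⟩ : ULift.{u} ℤ) ∈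
        zSet.{u} (k + 1) := by
      refine ⟨?_, ?_, fun _ => ?_⟩
      all_goals dsimp only; split_ifs <;> omega
    refine ⟨⟨_, hz⟩, Subtype.ext (ULift.ext _ _ ?_)⟩
    refine (h _).trans ?_
    simp only [shrink]
    split_ifs <;> omega

theorem HSP_Z_subset_succ {k : ℕ} (hk : 1 ≤ k) (hk' : 1 ≤ k + 1) :
    HSP {Z.{u} k hk} ⊆ HSP {Z.{u} (k + 1) hk'} :=
  HSP_subset_of_isVariety (isVariety_HSP _) (Set.singleton_subset_iff.2 (Z_mem_HSP_succ hk hk'))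

theorem HSP_Z_subset_SA {k : ℕ} (hk : 1 ≤ k) : HSP {Z.{u} k hk} ⊆ SA.{u} :=
  HSP_subset_of_isVariety (isVariety_HSP _) (Set.singleton_subset_iff.2
    (ISP_subset_HSP _ (mem_ISP.2 fun _ _ hab =>
      ⟨_, rfl, Subtype.val, isHom_val _ _ _, fun h => hab (Subtype.ext h)⟩)))

/-! ### Strictness of the inclusions. -/

/-- A homomorphism from `𝐙_k` to the integers that identifies two distinct elements sends the
elements of absolute value at most `1` to `0`. -/
theorem IsIntHom.eq_zero_of_eq {k : ℕ} (hk : 1 ≤ k) {f : (Z.{u} k hk).carrier → ℤ}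
    (hf : IsIntHom (Z.{u} k hk) f) {a b : (Z.{u} k hk).carrier} (hab : a.1.down < b.1.down)
    (heq : f a = f b) {d : (Z.{u} k hk).carrier} (hd : -1 ≤ d.1.down ∧ d.1.down ≤ 1) :
    f d = 0 := by
  have hv := isIntHom_Z.{u} k hk
  set v : (Z.{u} k hk).carrier → ℤ := fun x => x.1.down
  have hvinj : ∀ x y, v x = v y → x = y := fun x y h => Subtype.ext (ULift.ext _ _ h)
  have hab : v a < v b := hab
  have hd : -1 ≤ v d ∧ v d ≤ 1 := hd
  let A := Z.{u} k hk
  -- This is `a → b`, while `b → a = ¬c`, so `f c = 0`. As `a < b`, `c ≥ 1`; hence `d` lies between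
  -- `¬c` and `c`.
  let c := A.join (A.neg a) b
  have hvc : v c = max (-v a) (v b) := by rw [hv.map_join, hv.map_neg]
  have hc1 : A.imp a b = c := hvinj _ _ (by
    rw [hvc, hv.map_imp, intImp, if_pos hab.le])
  have hc2 : A.imp b a = A.neg c := hvinj _ _ (by
    rw [hv.map_neg, hvc, hv.map_imp, intImp, if_neg (by omega)]
    omega)
  have hfc : f c = -f c := by
    rw [← hf.map_neg]
    refine (congrArg f hc1).symm.trans (Eq.trans ?_ (congrArg f hc2))
    rw [hf.map_imp, hf.map_imp, heq]
  have h1 : A.meet d c = d := hvinj _ _ (by rw [hv.map_meet, hvc]; omega)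
  have h2 : A.join d (A.neg c) = d := hvinj _ _ (by
    rw [hv.map_join, hv.map_neg, hvc]; omega)
  have h3 : f d = min (f d) (f c) := by rw [← hf.map_meet]; exact congrArg f h1.symm
  have h4 : f d = max (f d) (-f c) := by
    rw [← hf.map_neg, ← hf.map_join]; exact congrArg f h2.symm
  omega

theorem Z_succ_notMem_HSP {k : ℕ} (hk : 1 ≤ k) (hk' : 1 ≤ k + 1) :
    Z.{u} (k + 1) hk' ∉ HSP {Z.{u} k hk} := by
  intro hA
  have hone : ∀ m : ℕ, 1 ≤ m → m ≤ (k + 1) / 2 →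
      (⟨m⟩ : ULift.{u} ℤ) ∈ zSet.{u} (k + 1) := fun m h1 h2 =>
    ⟨by dsimp only; omega, by dsimp only; omega, fun _ => by dsimp only; omega⟩
  let pt (m : ℕ) (h1 : 1 ≤ m) (h2 : m ≤ (k + 1) / 2) : (Z.{u} (k + 1) hk').carrier :=
    ⟨⟨m⟩, hone m h1 h2⟩
  have h2 : 1 ≤ (k + 1) / 2 := by omega
  let A := Z.{u} (k + 1) hk'
  let e := pt 1 le_rfl h2
  -- The largest element below `1`.
  obtain ⟨d, hd⟩ : ∃ d : A.carrier, d.1.down = if Even (k + 1) then -1 else 0 := by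
    refine ⟨⟨⟨if Even (k + 1) then -1 else 0⟩, ?_, ?_, fun h => ?_⟩, rfl⟩
    · dsimp only; split_ifs <;> omega
    · dsimp only; split_ifs <;> omega
    · dsimp only; rw [if_pos h]; omega
  have hdle : -1 ≤ d.1.down ∧ d.1.down ≤ 0 := by rw [hd]; split_ifs <;> omega
  have hed : e ≠ d := fun h => by
    have : e.1.down = 1 := rfl
    rw [h] at this
    omega
  obtain ⟨l, f, hl, hf, hz, hne⟩ := exists_isIntHom_separating hk hA hed
  -- Identifying any two points would send both `1` and `d` to `0`.
  have hinj : ∀ a b : A.carrier, a.1.down < b.1.down → f a < f b := by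
    intro a b hab
    refine lt_of_le_of_ne ?_ fun heq => hne ?_
    · have hm : A.meet a b = a := Subtype.ext (ULift.ext _ _ (min_eq_left hab.le))
      rw [← hm]
      change f ((Z.{u} (k + 1) hk').meet a b) ≤ _
      rw [hf.map_meet]
      exact min_le_right _ _
    · rw [hf.eq_zero_of_eq hk' hab heq (d := e) ⟨show (-1 : ℤ) ≤ 1 by decide, le_rfl⟩,
        hf.eq_zero_of_eq hk' hab heq (d := d) ⟨hdle.1, by omega⟩]
  have hf1 : 1 ≤ f e := by
    have h := hinj (A.neg e) e (show -(1 : ℤ) < 1 by decide)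
    have h' : f (A.neg e) = -f e := hf.map_neg e
    omega
  have hgrow : ∀ (m : ℕ) h1 h2, (m : ℤ) ≤ f (pt m h1 h2) := by
    intro m h1
    induction m, h1 using Nat.le_induction with
    | base => exact fun _ => hf1
    | succ m hm ih =>
      intro h2
      have h3 := ih (by omega)
      have h4 := hinj (pt m hm (by omega)) (pt (m + 1) (by omega) h2)
        (show (m : ℤ) < ((m + 1 : ℕ) : ℤ) by omega)
      push_cast
      omega
  have htop := hgrow _ h2 le_rfl
  have hle : f (pt _ h2 le_rfl) ≤ ((l / 2 : ℕ) : ℤ) := (hz _).2.1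
  -- For even `k`, `l = k` fails since `f d = 0` is not in `𝐙_k`; the other cases fail since `l / 2
  -- < (k + 1) / 2`.
  rcases Nat.even_or_odd k with he | ho
  · have hd0 : d.1.down = 0 := by rw [hd, if_neg (by grind)]
    have hfd : f d = -f d := by
      rw [← hf.map_neg]
      refine congrArg f (Subtype.ext (ULift.ext _ _ ?_))
      change d.1.down = -d.1.down
      omega
    rcases hl with rfl | ⟨-, hl⟩
    · exact (hz d).2.2 he (show f d = 0 by omega)
    · grind
  · rcases hl with rfl | ⟨he, -⟩ <;> grind

/-- `𝐙_{2m-1}` contains a fixed point of `¬`, so it has no homomorphism to `𝐙_{2m}`. -/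
theorem Z_odd_notMem_ISP {m : ℕ} (hm : 2 ≤ m) (he : 1 ≤ 2 * m) (ho : 1 ≤ 2 * m - 1) :
    Z.{u} (2 * m - 1) ho ∉ ISP {Z.{u} (2 * m) he} := by
  intro h
  have hodd : ¬ Even (2 * m - 1) := by grind
  let z : (Z.{u} (2 * m - 1) ho).carrier :=
    ⟨⟨0⟩, by dsimp only; omega, by dsimp only; omega, fun h => absurd h hodd⟩
  -- A second point, available as `2 ≤ m`, is needed: separation says nothing about the one-element
  -- algebra `𝐙_1`, an empty product.
  let w : (Z.{u} (2 * m - 1) ho).carrier :=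
    ⟨⟨1⟩, by dsimp only; omega, by dsimp only; omega, fun h => absurd h hodd⟩
  have hzw : z ≠ w := fun h => zero_ne_one (congrArg (fun x => x.1.down) h)
  obtain ⟨_, rfl, f, hf, -⟩ := mem_ISP.1 h z w hzw
  have hg := (isIntHom_Z.{u} (2 * m) he).comp_isHom hf
  have hneg : (Z.{u} (2 * m - 1) ho).neg z = z := Subtype.ext (ULift.ext _ _ neg_zero)
  have h1 := hg.map_neg z
  rw [hneg] at h1
  refine (f z).2.2.2 (even_two_mul m) ?_
  change (f z).1.down = -(f z).1.down at h1
  omega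

end Sugihara

theorem proposition3p1 :
    -- (i) for `m ≥ 1`
    (∀ (m : ℕ) (hm : 1 ≤ m) (ho : 1 ≤ 2 * m - 1),
      Sugihara.ISP {Sugihara.Z.{u} (2 * m - 1) ho} = Sugihara.HSP {Sugihara.Z.{u} (2 * m - 1) ho} ∧
      Sugihara.IsVariety (Sugihara.ISP {Sugihara.Z.{u} (2 * m - 1) ho})) ∧
    -- (ii) the inclusion is proper for `m ≥ 2`, the description of the variety holds for `m ≥ 1`
    (∀ (m : ℕ) (hm : 2 ≤ m) (he : 1 ≤ 2 * m),
      Sugihara.ISP {Sugihara.Z.{u} (2 * m) he} ⊂ Sugihara.HSP {Sugihara.Z.{u} (2 * m) he}) ∧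
    (∀ (m : ℕ) (hm : 1 ≤ m) (he : 1 ≤ 2 * m) (ho : 1 ≤ 2 * m - 1),
      Sugihara.HSP {Sugihara.Z.{u} (2 * m) he} =
        Sugihara.ISP {Sugihara.Z.{u} (2 * m) he, Sugihara.Z.{u} (2 * m - 1) ho}) ∧
    -- (iii) a strictly increasing chain of varieties properly contained in `SA`
    (∀ (k : ℕ) (hk : 1 ≤ k) (hk' : 1 ≤ k + 1),
      Sugihara.HSP {Sugihara.Z.{u} k hk} ⊂ Sugihara.HSP {Sugihara.Z.{u} (k + 1) hk'}) ∧
    (∀ (k : ℕ) (hk : 1 ≤ k),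
      Sugihara.HSP {Sugihara.Z.{u} k hk} ⊂ Sugihara.SA.{u}) := by
  refine ⟨fun m hm ho => ?_, fun m hm he => ?_, fun m hm he ho => ?_, fun k hk hk' => ?_,
    fun k hk => ?_⟩
  · have h : Sugihara.ISP {Sugihara.Z.{u} (2 * m - 1) ho} = Sugihara.HSP {Sugihara.Z _ ho} :=
      (Sugihara.ISP_subset_HSP _).antisymm (Sugihara.HSP_Z_subset_ISP_of_odd ho (by grind))
    exact ⟨h, h ▸ Sugihara.isVariety_HSP _⟩
  · refine ⟨Sugihara.ISP_subset_HSP _, fun h => ?_⟩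
    have hmem := Sugihara.Z_mem_HSP_succ.{u} (k := 2 * m - 1) (by omega) (by omega)
    rw [Sugihara.Z_eq_of_eq (by omega : 2 * m - 1 + 1 = 2 * m) _ he] at hmem
    exact Sugihara.Z_odd_notMem_ISP hm he (by omega) (h hmem)
  · have hmem := Sugihara.Z_mem_HSP_succ.{u} (k := 2 * m - 1) (by omega) (by omega)
    rw [Sugihara.Z_eq_of_eq (by omega : 2 * m - 1 + 1 = 2 * m) _ he] at hmem
    refine (Sugihara.HSP_Z_subset_ISP_pair he ho).antisymm ((Sugihara.ISP_subset_HSP _).trans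
      (Sugihara.HSP_subset_of_isVariety (Sugihara.isVariety_HSP _) ?_))
    exact Set.insert_subset (Sugihara.subset_HSP _ rfl) (Set.singleton_subset_iff.2 hmem)
  · exact ⟨Sugihara.HSP_Z_subset_succ hk hk', fun h =>
      Sugihara.Z_succ_notMem_HSP hk hk' (h (Sugihara.subset_HSP _ rfl))⟩
  · exact ⟨Sugihara.HSP_Z_subset_SA hk, fun h => Sugihara.Z_succ_notMem_HSP hk (by omega)
      (h (Sugihara.HSP_Z_subset_SA (by omega) (Sugihara.subset_HSP _ rfl)))⟩
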